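/- Let $p>3$ be a prime, let $q=p^s\equiv 1\pmod N$, and let $N,i,j,k$ be natural numbers with $1\le i,j,k<N$. Let $\xi$ be a complex character of $\mathbb F_q^\times$ of order $N$, and let $\lambda\in\mathbb F_q\setminus\{0,1\}$. All characters, including the trivial character $\varepsilon$, are extended to $\mathbb F_q$ by $\chi(0)=0$. For characters $A,B,C$ of $\mathbb F_q^\times$ put $$ {}_2F_1(A,B;C;\lambda)=\varepsilon(\lambda)\,\frac{BC(-1)}{q}\sum_{x\in\mathbb F_q}B(x)\,\overline{B}C(1-x)\,\overline{A}(1-\lambda x). $$ Let $X=X_\lambda^{[N;i,j,k]}$ be the desingularization of the complete curve with affine equation $y^N=x^i(1-x)^j(1-\lambda x)^k$ over $\mathbb F_q$, that is, the normalization of $\mathbb P^1_{\mathbb F_q}$ (with coordinate $x$) in the ring $\mathbb F_q(x)[y]/(y^N-x^i(1-x)^j(1-\lambda x)^k)$. Put $$ \begin{aligned} n_0&=\#\{w\in\mathbb F_q: w^{\gcd(N,i)}=1\},\\ n_1&=\#\{w\in\mathbb F_q: w^{\gcd(N,j)}=(1-\lambda)^k\},\\ n_{1/\lambda}&=\#\{w\in\mathbb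 F_q: w^{\gcd(N,k)}=(1/\lambda)^i(1-1/\lambda)^j\},\\ n_\infty&=\#\{w\in\mathbb F_q: w^{\gcd(N,n)}=(-1)^j(-\lambda)^k\},\qquad n=N+N\left\lfloor\tfrac{i+j+k}{N}\right\rfloor-(i+j+k). \end{aligned} $$ Then $n_0,n_1,n_{1/\lambda},n_\infty$ are the numbers of $\mathbb F_q$-rational points of $X$ lying over $x=0,\,1,\,1/\lambda,\,\infty$ respectively, the set $X(\mathbb F_q)$ is finite, and $$ \#X(\mathbb F_q)=1+q+q\sum_{m=1}^{N-1}\xi^{mj}(-1)\;{}_2F_1\!\left(\xi^{-km},\xi^{im};\xi^{m(i+j)};\lambda\right)+n_0+n_1+n_{1/\lambda}+n_\infty-4 . $$ -/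

import Mathlib

noncomputable section

namespace GenLegendre

open Polynomial

/-! ### The generalized Legendre curve `y ^ N = x ^ i (1 - x) ^ j (1 - lam x) ^ k` -/

section Curve

/-- The polynomial `x ^ i (1 - x) ^ j (1 - lam x) ^ k`. -/
def legendrePoly {F : Type*} [Field F] (i j k : ℕ) (lam : F) : F[X] :=
  X ^ i * (1 - X) ^ j * (1 - C lam * X) ^ k

/-- The total ring of fractions `F(x)[y] / (y ^ N - x ^ i (1 - x) ^ j (1 - lam x) ^ k)` of the
coordinate ring of the affine curve; it is the function field when the curve is irreducible. -/
abbrev FunctionRing {F : Type*} [Field F] (N i j k : ℕ) (lam : F) : Type _ :=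
  AdjoinRoot ((X : (RatFunc F)[X]) ^ N -
    C (algebraMap F[X] (RatFunc F) (legendrePoly i j k lam)))

/-- The function `x` on the curve. -/
def xFun {F : Type*} [Field F] (N i j k : ℕ) (lam : F) : FunctionRing N i j k lam :=
  algebraMap (RatFunc F) (FunctionRing N i j k lam) RatFunc.X

/-- The function `1 / x` on the curve. -/
def xInvFun {F : Type*} [Field F] (N i j k : ℕ) (lam : F) : FunctionRing N i j k lam :=
  algebraMap (RatFunc F) (FunctionRing N i j k lam) (RatFunc.X)⁻¹

/-- The integral closure of `F[u]` in `L`, as an `F`-algebra. -/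
def normalClosureAdjoin (F : Type*) {L : Type*} [Field F] [CommRing L] [Algebra F L] (u : L) :
    Subalgebra F L :=
  (integralClosure (Algebra.adjoin F {u}) L).restrictScalars F

theorem self_mem_normalClosureAdjoin (F : Type*) {L : Type*} [Field F] [CommRing L] [Algebra F L]
    (u : L) : u ∈ normalClosureAdjoin F u :=
  (integralClosure (Algebra.adjoin F {u}) L).algebraMap_mem
    ⟨u, Algebra.self_mem_adjoin_singleton F u⟩

/-- The set `X(F)` of `F`-rational points of the desingularization `X` of the (complete) curve
`y ^ N = x ^ i (1 - x) ^ j (1 - lam x) ^ k`.  The curve `X` is the normalization of the projective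
line in the ring of rational functions of the curve: it is covered by the spectrum of the integral
closure of `F[x]` and the spectrum of the integral closure of `F[1/x]`, glued along the open
subsets `x ≠ 0` and `1/x ≠ 0`.  An `F`-rational point of an affine `F`-scheme `Spec B` is a
homomorphism of `F`-algebras `B → F`.  So an `F`-rational point of `X` is either a point of the
first chart, or a point of the second chart outside the first one, i.e. with `1/x = 0`. -/
inductive RationalPoint {F : Type*} [Field F] (N i j k : ℕ) (lam : F) : Type _
  | finite (φ : normalClosureAdjoin F (xFun N i j k lam) →ₐ[F] F) :
      RationalPoint N i j k lam
  | infinite (φ : normalClosureAdjoin F (xInvFun N i j k lam) →ₐ[F] F)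
      (h : φ ⟨xInvFun N i j k lam, self_mem_normalClosureAdjoin F _⟩ = 0) :
      RationalPoint N i j k lam

/-- The map `x : X(F) → ℙ¹(F) = F ∪ {∞}`. -/
def RationalPoint.x {F : Type*} [Field F] {N i j k : ℕ} {lam : F} :
    RationalPoint N i j k lam → OnePoint F
  | .finite φ => ((φ ⟨xFun N i j k lam, self_mem_normalClosureAdjoin F _⟩ : F) : OnePoint F)
  | .infinite _ _ => OnePoint.infty

/-- The number of `F`-rational points of `X` lying over the point `P` of the projective line. -/
def numPointsOver {F : Type*} [Field F] (N i j k : ℕ) (lam : F) (P : OnePoint F) : ℕ :=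
  Nat.card {Q : RationalPoint N i j k lam // Q.x = P}

end Curve

/-! ### The numbers attached to the four singularities

If the curve is `t ^ N = s ^ n f(s)` near a singularity `s = 0`, with `f(0) = a ≠ 0`, the number
attached to it is `#{w ∈ F : w ^ gcd(N, n) = a}`. -/

section Singularities

/-- The number of `w ∈ F` with `w ^ gcd(N, n) = a`. -/
def resolutionCount {F : Type*} [Field F] (N n : ℕ) (a : F) : ℕ :=
  Nat.card {w : F // w ^ Nat.gcd N n = a}

/-- At `x = 0`: `s = x`, `t = y`, `f(s) = (1 - s) ^ j (1 - lam s) ^ k`, `n = i`. -/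
def nZero (F : Type*) [Field F] (N i : ℕ) : ℕ := resolutionCount N i (1 : F)

/-- At `x = 1`: `s = 1 - x`, `t = y`, `f(s) = (1 - s) ^ i (1 - lam + lam s) ^ k`, `n = j`. -/
def nOne {F : Type*} [Field F] (N j k : ℕ) (lam : F) : ℕ := resolutionCount N j ((1 - lam) ^ k)

/-- At `x = 1 / lam`: `s = 1 - lam x`, `t = y`,
`f(s) = ((1 - s) / lam) ^ i (1 - (1 - s) / lam) ^ j`, `n = k`. -/
def nInvLam {F : Type*} [Field F] (N i j k : ℕ) (lam : F) : ℕ :=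
  resolutionCount N k ((1 / lam) ^ i * (1 - 1 / lam) ^ j)

/-- At `x = ∞`: `s = 1 / x`, `t = y s ^ e` with `e = ⌊(i + j + k) / N⌋ + 1`,
`f(s) = (s - 1) ^ j (s - lam) ^ k`, `n = N e - (i + j + k) > 0`. -/
def nInfty {F : Type*} [Field F] (N i j k : ℕ) (lam : F) : ℕ :=
  resolutionCount N (N * ((i + j + k) / N + 1) - (i + j + k)) ((-1) ^ j * (-lam) ^ k)

end Singularities

/-! ### The hypergeometric function over a finite field -/

/-- Greene's `₂F₁(A, B; C; lam)` over the finite field `F`, for complex multiplicative characters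
(all of which, the trivial one included, vanish at `0`). -/
def hyp2F1 {F : Type*} [Field F] [Fintype F] (A B C : MulChar F ℂ) (lam : F) : ℂ :=
  (1 : MulChar F ℂ) lam * ((B * C) (-1) / (Fintype.card F : ℂ)) *
    ∑ x : F, B x * (B⁻¹ * C) (1 - x) * A⁻¹ (1 - lam * x)

end GenLegendre

end

/-!
The curve is a Kummer extension `L = K[y] / (y ^ N - f)` of `K = F(x)`, with `N` invertible in `F` and
all `N`-th roots of unity in `F`. Averaging over the automorphisms `y ↦ ζ y` splits the integral
closure `B` of `F[x]` in `L` into its eigencomponents `g y ^ m` (`isIntegral_component`), and this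
makes the points over a given point `x = c` of the line explicit.

Let `s` be a local parameter at `c` and write `f = s ^ n u` with `u(c) ≠ 0`, `N = d N'` and
`n = d n'`, where `d = gcd(N, n)`. The function `v = s ^ (-n') y ^ N'` satisfies `v ^ d = u`, so a
point `φ : B → F` over `c` gives a solution `w = φ(v)` of `w ^ d = u(c)`. This is a bijection.
* It is injective because `φ(v)` determines `φ` on each eigencomponent: `(g y ^ m) ^ N` is a function
  of `x`, and either it vanishes at `c`, or it has order `0` there and then `g y ^ m` is a power of
  `v` times a function of `x` that is regular at `c` (`exists_apply_component_eq`).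
* It is surjective because the only relation between `x` and `v` is `v ^ d = u(x)`, so every solution
  `w` defines a maximal ideal of `F[x, v]`. A maximal ideal of `B` lies over it, and the argument
  for injectivity shows that its residue field is `F` (`nonempty_algHom_equiv_pow_eq`).

The same statement applies at infinity, with `1 / x` as the function generating `K` and with a
negative exponent `n`.

For `c ≠ 0, 1, 1 / lam` the exponent is `n = 0`, and the number of points over `c` is the number of
`w` with `w ^ N = f(c)`, which is `∑_{m < N} ξ(f(c)) ^ m` (`card_pow_eq_sum_mulChar`). At the three
other finite points `ξ(f(c)) = 0`. Summation over `c` turns the terms with `m ≥ 1` into the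
hypergeometric sums (`card_mul_mulChar_mul_hyp2F1`); the terms with `m = 0` contribute `q - 3`.
-/

namespace GenLegendre

open Polynomial

/-! ### Eigencomponents of the integral closure in a Kummer extension -/

section Kummer

variable {F K L : Type*} [Field F] [Field K] [CommRing L] [Algebra F K] [Algebra F L]
  [Algebra K L] [IsScalarTower F K L] {N : ℕ} {f : K}

theorem root_pow (h : IsAdjoinRoot L (X ^ N - C f)) : h.root ^ N = algebraMap K L f := by
  have := h.aeval_root_self
  rwa [map_sub, map_pow, aeval_X, aeval_C, sub_eq_zero] at this

theorem exists_eq_sum_smul_root_pow (h : IsAdjoinRoot L (X ^ N - C f)) (hN : N ≠ 0) (b : L) :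
    ∃ g : ℕ → K, b = ∑ m ∈ Finset.range N, g m • h.root ^ m := by
  obtain ⟨P, rfl⟩ := h.map_surjective b
  have hmon : (X ^ N - C f : K[X]).Monic := monic_X_pow_sub_C f hN
  refine ⟨(P %ₘ (X ^ N - C f)).coeff, ?_⟩
  have h1 : h.map P = h.map (P %ₘ (X ^ N - C f)) := by
    conv_lhs => rw [← modByMonic_add_div P (X ^ N - C f)]
    rw [map_add, map_mul, h.map_self, zero_mul, add_zero]
  have h2 : (P %ₘ (X ^ N - C f)).natDegree < N := by
    have := natDegree_modByMonic_lt P hmon (by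
      intro h
      have := natDegree_X_pow_sub_C (n := N) (r := f)
      rw [h, natDegree_one] at this
      exact hN this.symm)
    rwa [natDegree_X_pow_sub_C] at this
  rw [h1, ← h.aeval_root_eq_map, aeval_eq_sum_range' h2]

theorem exists_algHom_root_eq_smul (h : IsAdjoinRoot L (X ^ N - C f)) {ζ : K} (hζ : ζ ^ N = 1) :
    ∃ σ : L →ₐ[K] L, σ h.root = ζ • h.root :=
  ⟨h.liftHom (ζ • h.root) (by simp [_root_.smul_pow, hζ, root_pow h]), by simp⟩

theorem isIntegral_map_of_algHom (σ : L →ₐ[K] L) {x : K} {b : L}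
    (hb : IsIntegral (Algebra.adjoin F {algebraMap K L x}) b) :
    IsIntegral (Algebra.adjoin F {algebraMap K L x}) (σ b) := by
  let τ : L →ₐ[Algebra.adjoin F {algebraMap K L x}] L :=
    { σ with
      commutes' := fun z => by
        have : Algebra.adjoin F {algebraMap K L x} ≤
            AlgHom.equalizer (σ.restrictScalars F) (AlgHom.id F L) := by
          rw [Algebra.adjoin_le_iff, Set.singleton_subset_iff]
          exact σ.commutes x
        exact this z.2 }
  exact hb.map τ

/-- The eigencomponents of an integral element under `y ↦ ζ y` are integral, because the averages
that compute them have coefficients in `F`. -/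
theorem isIntegral_component (h : IsAdjoinRoot L (X ^ N - C f)) {ζ : F} (hζ : IsPrimitiveRoot ζ N)
    (hNF : (N : F) ≠ 0) {x : K} (g : ℕ → K)
    (hb : IsIntegral (Algebra.adjoin F {algebraMap K L x})
      (∑ m ∈ Finset.range N, g m • h.root ^ m))
    {m : ℕ} (hm : m < N) :
    IsIntegral (Algebra.adjoin F {algebraMap K L x}) (g m • h.root ^ m) := by
  set A₁ := Algebra.adjoin F {algebraMap K L x}
  have hzt : ∀ t : ℕ, (algebraMap F K (ζ ^ t)) ^ N = 1 := fun t => by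
    rw [← map_pow, ← pow_mul, mul_comm, pow_mul, hζ.pow_eq_one, one_pow, map_one]
  have hF : ∀ a : F, IsIntegral A₁ (algebraMap F L a) := fun a =>
    isIntegral_algebraMap (R := A₁) (A := L) (x := algebraMap F A₁ a)
  choose σ hσ using fun t => exists_algHom_root_eq_smul h (hzt t)
  have hrot : ∀ t : ℕ, σ t (∑ n ∈ Finset.range N, g n • h.root ^ n)
      = ∑ n ∈ Finset.range N, algebraMap F L (ζ ^ (t * n)) * (g n • h.root ^ n) := fun t => by
    rw [map_sum]
    refine Finset.sum_congr rfl fun n _ => ?_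
    rw [map_smul, map_pow, hσ, _root_.smul_pow, smul_comm, ← map_pow, ← pow_mul,
      IsScalarTower.algebraMap_apply F K L, ← Algebra.smul_def]
  -- The average of the rotates with weights `ζ ^ (-t m)`, written with exponent `t (N - m)`.
  have hkey : g m • h.root ^ m = algebraMap F L (N : F)⁻¹ * ∑ t ∈ Finset.range N,
      algebraMap F L (ζ ^ (t * (N - m))) *
        σ t (∑ n ∈ Finset.range N, g n • h.root ^ n) := by
    simp_rw [hrot, Finset.mul_sum]
    rw [Finset.sum_comm, Finset.sum_eq_single_of_mem m (Finset.mem_range.2 hm)]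
    · have : ∀ t ∈ Finset.range N, algebraMap F L (N : F)⁻¹ * (algebraMap F L (ζ ^ (t * (N - m))) *
          (algebraMap F L (ζ ^ (t * m)) * (g m • h.root ^ m)))
          = algebraMap F L (N : F)⁻¹ * (g m • h.root ^ m) := fun t _ => by
        rw [← mul_assoc (algebraMap F L (ζ ^ (t * (N - m)))), ← map_mul, ← pow_add, ← mul_add,
          Nat.sub_add_cancel hm.le, mul_comm t, pow_mul, hζ.pow_eq_one, one_pow, map_one, one_mul]
      rw [Finset.sum_congr rfl this, Finset.sum_const, Finset.card_range, nsmul_eq_mul, ← mul_assoc,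
        ← map_natCast (algebraMap F L), ← map_mul, mul_inv_cancel₀ hNF, map_one, one_mul]
    · intro n hn hnm
      have hn' := Finset.mem_range.1 hn
      have h1 : ζ ^ (N - m + n) ≠ 1 := fun h => by
        have := (hζ.pow_eq_one_iff_dvd _).1 h
        obtain ⟨c, hc⟩ := this
        have hc2 : c < 2 := by
          by_contra hc3
          have : N * 2 ≤ N * c := Nat.mul_le_mul_left _ (not_lt.1 hc3)
          omega
        interval_cases c <;> omega
      have h2 : ∑ t ∈ Finset.range N, (ζ ^ (N - m + n)) ^ t = 0 := by
        have := geom_sum_mul (ζ ^ (N - m + n)) N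
        rw [← pow_mul, mul_comm _ N, pow_mul, hζ.pow_eq_one, one_pow, sub_self] at this
        exact (mul_eq_zero.1 this).resolve_right (sub_ne_zero.2 h1)
      have : ∀ t ∈ Finset.range N, algebraMap F L (N : F)⁻¹ * (algebraMap F L (ζ ^ (t * (N - m))) *
          (algebraMap F L (ζ ^ (t * n)) * (g n • h.root ^ n)))
          = algebraMap F L ((ζ ^ (N - m + n)) ^ t) *
            (algebraMap F L (N : F)⁻¹ * (g n • h.root ^ n)) := fun t _ => by
        rw [← mul_assoc (algebraMap F L (ζ ^ (t * (N - m)))), ← map_mul, ← pow_add, ← mul_add,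
          mul_comm t, pow_mul]
        ring
      rw [Finset.sum_congr rfl this, ← Finset.sum_mul, ← map_sum, h2, map_zero, zero_mul]
  rw [hkey]
  exact (hF _).mul (IsIntegral.sum _ fun t _ => (hF _).mul (isIntegral_map_of_algHom _ hb))

end Kummer

/-! ### Values of integral functions at a point over `x = c` -/

section Local

universe v
variable {K : Type*} {F L : Type v} [Field F] [Field K] [CommRing L] [Algebra F K]
  [Algebra K L] {N : ℕ} {f : K}

/-- Given a factorization `f = s ^ n * u` with `s = S(x)`, `N = d * N'` and `n = d * n'`, the
function `v = s ^ (-n') * y ^ N'`, which satisfies `v ^ d = u`. -/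
noncomputable def branchFun (h : IsAdjoinRoot L (X ^ N - C f)) (x : K) (S : F[X]) (N' : ℕ) (n' : ℤ) :
    L :=
  algebraMap K L (aeval x S ^ (-n')) * h.root ^ N'

theorem branchFun_pow (h : IsAdjoinRoot L (X ^ N - C f)) {x : K} {S u : F[X]} {d N' : ℕ} {n' : ℤ}
    (hN : N = d * N') (hS : aeval x S ≠ 0) (hf : f = aeval x S ^ (d * n') * aeval x u) :
    branchFun h x S N' n' ^ d = algebraMap K L (aeval x u) := by
  have h1 : (h.root ^ N') ^ d = algebraMap K L f := by
    rw [← pow_mul, mul_comm, ← hN, root_pow]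
  rw [branchFun, mul_pow, h1, ← map_pow, ← map_mul, hf, ← mul_assoc, ← zpow_natCast, ← zpow_mul,
    ← zpow_add₀ hS]
  congr 1
  rw [show -n' * (d : ℤ) + d * n' = 0 by ring, zpow_zero, one_mul]

variable [Algebra F L] [IsScalarTower F K L]

theorem aeval_mem_normalClosureAdjoin (x : L) (P : F[X]) : aeval x P ∈ normalClosureAdjoin F x :=
  Algebra.adjoin_le (Set.singleton_subset_iff.2 (self_mem_normalClosureAdjoin F x))
    (aeval_mem_adjoin_singleton F x)

theorem branchFun_mem (h : IsAdjoinRoot L (X ^ N - C f)) {x : K} {S u : F[X]} {d N' : ℕ} {n' : ℤ}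
    (hN : N = d * N') (hd : 0 < d) (hS : aeval x S ≠ 0)
    (hf : f = aeval x S ^ (d * n') * aeval x u) :
    branchFun h x S N' n' ∈ normalClosureAdjoin F (algebraMap K L x) := by
  refine IsIntegral.of_pow (R := Algebra.adjoin F {algebraMap K L x}) hd ?_
  rw [branchFun_pow h hN hS hf, ← aeval_algebraMap_apply]
  exact aeval_mem_normalClosureAdjoin _ _

/-- The value of an integral eigenfunction `g y ^ m` at a point over `x = c` is determined by the
value `w` of `v` at that point: write `g = s ^ r A(x) / B(x)` with `A(c)` and `B(c)` nonzero.
If `N r + n m > 0`, the value is `0`; if `N r + n m = 0`, then `g y ^ m = A / B * v ^ l`; and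
`N r + n m < 0` is impossible. -/
theorem exists_apply_component_eq (h : IsAdjoinRoot L (X ^ N - C f)) {x : K} {S u : F[X]}
    {d N' : ℕ} {n' : ℤ} (hN : N = d * N') (hd : 0 < d) (hN' : 0 < N')
    (hcop : IsCoprime (N' : ℤ) n') (hS : aeval x S ≠ 0)
    (hf : f = aeval x S ^ (d * n') * aeval x u)
    {c : F} (hSc : S.eval c = 0) (huc : u.eval c ≠ 0)
    (hgen : ∀ g : K, g ≠ 0 → ∃ (r : ℤ) (A B : F[X]), A.eval c ≠ 0 ∧ B.eval c ≠ 0 ∧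
      g * aeval x B = aeval x S ^ r * aeval x A)
    (w : F) (g : K) (m : ℕ)
    (hb : g • h.root ^ m ∈ normalClosureAdjoin F (algebraMap K L x)) :
    ∃ e : F, ∀ (E : Type v) [CommRing E] [IsDomain E] [Algebra F E]
      (φ : normalClosureAdjoin F (algebraMap K L x) →ₐ[F] E),
      φ ⟨_, self_mem_normalClosureAdjoin F _⟩ = algebraMap F E c →
      φ ⟨_, branchFun_mem h hN hd hS hf⟩ = algebraMap F E w →
      φ ⟨_, hb⟩ = algebraMap F E e := by
  by_cases hg : g = 0
  · refine ⟨0, fun E _ _ _ φ _ _ => ?_⟩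
    rw [map_zero, ← map_zero φ]
    congr 1
    ext
    simp [hg]
  obtain ⟨r, A, B, hA, hB, hgAB⟩ := hgen g hg
  set x' : normalClosureAdjoin F (algebraMap K L x) := ⟨_, self_mem_normalClosureAdjoin F _⟩
  set v' : normalClosureAdjoin F (algebraMap K L x) := ⟨_, branchFun_mem h hN hd hS hf⟩
  set b' : normalClosureAdjoin F (algebraMap K L x) := ⟨_, hb⟩
  have hcoe : ∀ P : F[X], ((aeval x' P : normalClosureAdjoin F (algebraMap K L x)) : L)
      = algebraMap K L (aeval x P) := fun P => by
    rw [← aeval_algebraMap_apply, ← Subalgebra.coe_val, ← aeval_algHom_apply]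
    rfl
  have hval : ∀ (E : Type v) [CommRing E] [Algebra F E]
      (φ : normalClosureAdjoin F (algebraMap K L x) →ₐ[F] E), φ x' = algebraMap F E c →
      ∀ P : F[X], φ (aeval x' P) = algebraMap F E (P.eval c) := fun E _ _ φ hφ P => by
    rw [← aeval_algHom_apply, hφ, aeval_algebraMap_apply, coe_aeval_eq_eval]
  have hne : ∀ (E : Type v) [CommRing E] [IsDomain E] [Algebra F E] (a : F), a ≠ 0 →
      algebraMap F E a ≠ 0 := fun E _ _ _ a ha => by
    rwa [Ne, map_eq_zero_iff _ (algebraMap F E).injective]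
  -- The `N`-th power of `g y ^ m` is a function of `x`.
  have hpow : (g ^ N * f ^ m) * aeval x B ^ N
      = aeval x S ^ (N * r + d * n' * m) * (aeval x A ^ N * aeval x u ^ m) := by
    have h1 : (g ^ N * f ^ m) * aeval x B ^ N = (g * aeval x B) ^ N * f ^ m := by ring
    have h2 : aeval x S ^ (N * r + d * n' * m) = (aeval x S ^ r) ^ N * (aeval x S ^ (d * n')) ^ m := by
      rw [zpow_add₀ hS, mul_comm (N : ℤ), zpow_mul, zpow_natCast, zpow_mul _ (d * n'), zpow_natCast]
    rw [h1, hgAB, hf, h2, mul_pow, mul_pow, mul_mul_mul_comm]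
  have hbN : (g • h.root ^ m) ^ N = algebraMap K L (g ^ N * f ^ m) := by
    rw [_root_.smul_pow, ← pow_mul, mul_comm m, pow_mul, root_pow, Algebra.smul_def, map_mul,
      map_pow (algebraMap K L) f]
  -- `N r + n m` is the order of `(g y ^ m) ^ N` at `x = c`.
  rcases lt_trichotomy (N * r + d * n' * m) 0 with hT | hT | hT
  · refine ⟨0, fun E _ _ _ φ hφx _ => ?_⟩
    exfalso
    obtain ⟨t, ht⟩ := Int.eq_ofNat_of_zero_le (neg_nonneg.2 hT.le)
    have ht0 : t ≠ 0 := by omega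
    have h1 : b' ^ N * aeval x' (B ^ N * S ^ t) = aeval x' (A ^ N * u ^ m) := by
      ext
      rw [MulMemClass.coe_mul, SubmonoidClass.coe_pow, hcoe, hcoe, hbN, ← map_mul]
      congr 1
      have h2 : aeval x S ^ (N * r + d * n' * m) * aeval x S ^ t = 1 := by
        rw [← zpow_natCast, ← zpow_add₀ hS, show (t : ℤ) = -(N * r + d * n' * m) from ht.symm,
          add_neg_cancel, zpow_zero]
      rw [map_mul, map_mul, map_pow, map_pow, map_pow, map_pow, ← mul_assoc, hpow,
        mul_right_comm, h2, one_mul]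
    have h3 := congrArg φ h1
    rw [map_mul, hval E φ hφx, hval E φ hφx, eval_mul, eval_pow (p := S), hSc, zero_pow ht0, mul_zero,
      map_zero, mul_zero, eval_mul, eval_pow, eval_pow] at h3
    exact hne E _ (mul_ne_zero (pow_ne_zero _ hA) (pow_ne_zero _ huc)) h3.symm
  · have h1 : (N' : ℤ) * r + n' * m = 0 := by
      have : (d : ℤ) * (N' * r + n' * m) = 0 := by rw [← hT, hN]; push_cast; ring
      exact (mul_eq_zero.1 this).resolve_left (by exact_mod_cast hd.ne')
    have h2 : (N' : ℤ) ∣ m := hcop.dvd_of_dvd_mul_left ⟨-r, by linarith⟩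
    obtain ⟨l, rfl⟩ : N' ∣ m := by exact_mod_cast h2
    have h3 : r = -n' * l := by
      have : (N' : ℤ) * (r + n' * l) = 0 := by rw [← h1]; push_cast; ring
      have := (mul_eq_zero.1 this).resolve_left (by exact_mod_cast hN'.ne')
      linarith
    refine ⟨A.eval c * w ^ l / B.eval c, fun E _ _ _ φ hφx hφv => ?_⟩
    have h4 : b' * aeval x' B = aeval x' A * v' ^ l := by
      ext
      rw [MulMemClass.coe_mul, MulMemClass.coe_mul, SubmonoidClass.coe_pow, hcoe, hcoe]
      change g • h.root ^ (N' * l) * _ = _ * branchFun h x S N' n' ^ l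
      rw [Algebra.smul_def, mul_right_comm, ← map_mul, hgAB, branchFun, mul_pow, ← map_pow,
        ← pow_mul, ← mul_assoc, ← map_mul, h3, zpow_mul, zpow_natCast, mul_comm (aeval x A)]
    have h5 := congrArg φ h4
    rw [map_mul, map_mul, map_pow, hval E φ hφx, hval E φ hφx, hφv, ← map_pow, ← map_mul] at h5
    refine mul_right_cancel₀ (hne E _ hB) ?_
    rw [h5, ← map_mul, div_mul_cancel₀ _ hB]
  · refine ⟨0, fun E _ _ _ φ hφx _ => ?_⟩
    obtain ⟨t, ht⟩ := Int.eq_ofNat_of_zero_le hT.le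
    have ht0 : t ≠ 0 := by omega
    have hN0 : N ≠ 0 := by rw [hN]; positivity
    have h1 : b' ^ N * aeval x' (B ^ N) = aeval x' (S ^ t * (A ^ N * u ^ m)) := by
      ext
      rw [MulMemClass.coe_mul, SubmonoidClass.coe_pow, hcoe, hcoe, hbN, ← map_mul]
      congr 1
      rw [map_mul, map_mul, map_pow, map_pow, map_pow, map_pow, hpow, ht]
      simp
    have h3 := congrArg φ h1
    rw [map_mul, map_pow, hval E φ hφx, hval E φ hφx, eval_mul, eval_pow (p := S), hSc, zero_pow ht0,
      zero_mul, map_zero, eval_pow] at h3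
    rw [map_zero]
    exact pow_eq_zero_iff hN0 |>.1 ((mul_eq_zero.1 h3).resolve_right (hne E _ (pow_ne_zero _ hB)))

/-- The value of every integral function at a point over `x = c` lies in `F` and is determined by
the value of `v`. The target `E` is arbitrary, so that this also computes the residue field of a
maximal ideal over `x = c`, `v = w`. -/
theorem exists_apply_eq (h : IsAdjoinRoot L (X ^ N - C f)) {x : K} {S u : F[X]}
    {d N' : ℕ} {n' : ℤ} (hN : N = d * N') (hd : 0 < d) (hN' : 0 < N')
    (hcop : IsCoprime (N' : ℤ) n') (hS : aeval x S ≠ 0)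
    (hf : f = aeval x S ^ (d * n') * aeval x u)
    {c : F} (hSc : S.eval c = 0) (huc : u.eval c ≠ 0)
    (hgen : ∀ g : K, g ≠ 0 → ∃ (r : ℤ) (A B : F[X]), A.eval c ≠ 0 ∧ B.eval c ≠ 0 ∧
      g * aeval x B = aeval x S ^ r * aeval x A)
    {ζ : F} (hζ : IsPrimitiveRoot ζ N) (hNF : (N : F) ≠ 0)
    (w : F) (b : normalClosureAdjoin F (algebraMap K L x)) :
    ∃ e : F, ∀ (E : Type v) [CommRing E] [IsDomain E] [Algebra F E]
      (φ : normalClosureAdjoin F (algebraMap K L x) →ₐ[F] E),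
      φ ⟨_, self_mem_normalClosureAdjoin F _⟩ = algebraMap F E c →
      φ ⟨_, branchFun_mem h hN hd hS hf⟩ = algebraMap F E w →
      φ b = algebraMap F E e := by
  have hN0 : N ≠ 0 := by rw [hN]; positivity
  obtain ⟨b, hb⟩ := b
  obtain ⟨g, rfl⟩ := exists_eq_sum_smul_root_pow h hN0 b
  have hmem : ∀ m : Finset.range N, g m • h.root ^ (m : ℕ) ∈
      normalClosureAdjoin F (algebraMap K L x) := fun m =>
    isIntegral_component h hζ hNF g hb (Finset.mem_range.1 m.2)
  choose e he using fun m : Finset.range N =>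
    exists_apply_component_eq h hN hd hN' hcop hS hf hSc huc hgen w (g m) m (hmem m)
  refine ⟨∑ m, e m, fun E _ _ _ φ hφx hφv => ?_⟩
  have hsum : (⟨_, hb⟩ : normalClosureAdjoin F (algebraMap K L x)) = ∑ m, ⟨_, hmem m⟩ := by
    ext
    rw [AddSubmonoidClass.coe_finsetSum]
    exact (Finset.sum_coe_sort (Finset.range N) fun m => g m • h.root ^ m).symm
  rw [hsum, map_sum, map_sum]
  exact Finset.sum_congr rfl fun m _ => he m E φ hφx hφv

end Local

/-! ### Existence of rational points by lying over -/

section LyingOver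

universe v
variable {K : Type*} {F L : Type v} [Field F] [Field K] [CommRing L] [Algebra F K]
  [Algebra K L] {N : ℕ} {f : K}

/-- The only relation between `x` and `v` is `v ^ d = u(x)`. -/
theorem dvd_of_eval₂_branchFun_eq_zero (h : IsAdjoinRoot L (X ^ N - C f)) {x : K}
    (hx : Transcendental F x) {S u : F[X]}
    {d N' : ℕ} {n' : ℤ} (hN : N = d * N') (hd : 0 < d) (hN' : 0 < N') (hS : aeval x S ≠ 0)
    (hf : f = aeval x S ^ (d * n') * aeval x u) (p : F[X][X])
    (hp : eval₂ ((algebraMap K L).comp (aeval x).toRingHom) (branchFun h x S N' n') p = 0) :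
    X ^ d - C u ∣ p := by
  have hmon : (X ^ d - C u : F[X][X]).Monic := monic_X_pow_sub_C u hd.ne'
  rw [← modByMonic_eq_zero_iff_dvd hmon]
  set r := p %ₘ (X ^ d - C u) with hr
  have hrd : r.natDegree < d := by
    have := natDegree_modByMonic_lt p hmon (by
      intro h
      have := natDegree_X_pow_sub_C (n := d) (r := u)
      rw [h, natDegree_one] at this
      exact hd.ne this)
    rwa [natDegree_X_pow_sub_C] at this
  have hrv : eval₂ ((algebraMap K L).comp (aeval x).toRingHom) (branchFun h x S N' n') r = 0 := by
    rw [← modByMonic_add_div p (X ^ d - C u), eval₂_add, eval₂_mul] at hp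
    rw [← hp, eval₂_sub, eval₂_pow, eval₂_X, eval₂_C, branchFun_pow h hN hS hf]
    simp [hr]
  -- In terms of `y`, the function `v` is `T(y)`, and `r(x, T(y))` has degree less than `N`.
  set T : K[X] := C (aeval x S ^ (-n')) * X ^ N'
  have hT : T.natDegree = N' := natDegree_C_mul_X_pow _ _ (zpow_ne_zero _ hS)
  have hmap : h.map ((r.map (aeval x).toRingHom).comp T) = 0 := by
    rw [← h.aeval_root_eq_map, aeval_comp, aeval_def, eval₂_map, ← hrv]
    simp [T, branchFun, ← h.algebraMap_apply]
  have hzero : (r.map (aeval x).toRingHom).comp T = 0 := by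
    refine eq_zero_of_dvd_of_natDegree_lt (h.map_eq_zero_iff.1 hmap) ?_
    rw [natDegree_comp, hT, natDegree_X_pow_sub_C, hN]
    exact Nat.mul_lt_mul_of_pos_right (natDegree_map_le.trans_lt hrd) hN'
  have hrm : r.map (aeval x).toRingHom = 0 := by
    rcases comp_eq_zero_iff.1 hzero with h1 | ⟨_, h2⟩
    · exact h1
    · rw [h2, natDegree_C] at hT
      exact absurd hT hN'.ne
  exact (Polynomial.map_eq_zero_iff (transcendental_iff_injective.1 hx)).1 hrm

variable [Algebra F L]

/-- The map `F[x] → B` to the integral closure `B` of `F[x]` is integral. -/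
theorem isIntegral_aeval_self (x : L) :
    (aeval (R := F) (⟨x, self_mem_normalClosureAdjoin F x⟩ :
      normalClosureAdjoin F x)).toRingHom.IsIntegral := by
  have hσ : (algebraMap (Algebra.adjoin F {x})
      (integralClosure (Algebra.adjoin F {x}) L)).IsIntegral :=
    algebraMap_isIntegral_iff.2 inferInstance
  let π : F[X] →+* Algebra.adjoin F {x} :=
    (aeval (⟨x, Algebra.self_mem_adjoin_singleton F x⟩ : Algebra.adjoin F {x})).toRingHom
  have hπ : Function.Surjective π := by
    rintro ⟨t, ht⟩
    obtain ⟨r, rfl⟩ := Algebra.adjoin_mem_exists_aeval _ _ ht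
    exact ⟨r, by ext; simp [π]⟩
  have hcomp : (aeval (R := F) (⟨x, self_mem_normalClosureAdjoin F x⟩ :
      normalClosureAdjoin F x)).toRingHom = (algebraMap (Algebra.adjoin F {x})
      (integralClosure (Algebra.adjoin F {x}) L)).comp π := by
    refine RingHom.ext fun P => Subtype.ext ?_
    have h1 : (((aeval (R := F) (⟨x, self_mem_normalClosureAdjoin F x⟩ :
      normalClosureAdjoin F x)) P : normalClosureAdjoin F x) : L) = aeval x P := by
      rw [← Subalgebra.coe_val, ← aeval_algHom_apply]
      rfl
    have h2 : ((π P : Algebra.adjoin F {x}) : L) = aeval x P := by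
      change (Algebra.adjoin F {x}).val (aeval _ P) = _
      rw [← aeval_algHom_apply]
      rfl
    exact h1.trans h2.symm
  rw [hcomp]
  exact (RingHom.isIntegral_of_surjective π hπ).trans _ _ hσ

variable [IsScalarTower F K L]

/-- If the function `x` generates `K` over `F` and `f = s ^ n * u(x)`, where `s = S(x)` is a local
parameter at `x = c` and `u(c) ≠ 0`, then the `F`-rational points over `x = c` correspond to the
solutions of `w ^ gcd(N, n) = u(c)`. -/
theorem nonempty_algHom_equiv_pow_eq (h : IsAdjoinRoot L (X ^ N - C f)) {x : K}
    (hx : Transcendental F x) {S u : F[X]} {n : ℤ} (hN0 : N ≠ 0) (hS : aeval x S ≠ 0)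
    (hf : f = aeval x S ^ n * aeval x u)
    {c : F} (hSc : S.eval c = 0) (huc : u.eval c ≠ 0)
    (hgen : ∀ g : K, g ≠ 0 → ∃ (r : ℤ) (A B : F[X]), A.eval c ≠ 0 ∧ B.eval c ≠ 0 ∧
      g * aeval x B = aeval x S ^ r * aeval x A)
    {ζ : F} (hζ : IsPrimitiveRoot ζ N) (hNF : (N : F) ≠ 0) :
    Nonempty ({φ : normalClosureAdjoin F (algebraMap K L x) →ₐ[F] F //
        φ ⟨_, self_mem_normalClosureAdjoin F _⟩ = c} ≃
      {w : F // w ^ Int.gcd N n = u.eval c}) := by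
  obtain ⟨d, hdef⟩ : ∃ d, d = Int.gcd N n := ⟨_, rfl⟩
  have hd : 0 < d := hdef ▸ Int.gcd_pos_of_ne_zero_left n (by exact_mod_cast hN0)
  obtain ⟨N', hN⟩ : d ∣ N := by
    have : (d : ℤ) ∣ N := hdef ▸ Int.gcd_dvd_left ..
    exact_mod_cast this
  obtain ⟨n', rfl⟩ : (d : ℤ) ∣ n := hdef ▸ Int.gcd_dvd_right ..
  have hN' : 0 < N' := Nat.pos_of_ne_zero fun h0 => hN0 (by rw [hN, h0, mul_zero])
  have hcop : IsCoprime (N' : ℤ) n' := by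
    rw [Int.isCoprime_iff_gcd_eq_one]
    rw [hN, Nat.cast_mul, Int.gcd_mul_left, Int.natAbs_natCast] at hdef
    exact Nat.eq_of_mul_eq_mul_left hd (by rw [mul_one]; exact hdef.symm)
  rw [← hdef]
  set B := normalClosureAdjoin F (algebraMap K L x)
  set x' : B := ⟨_, self_mem_normalClosureAdjoin F _⟩ with hx'
  set v' : B := ⟨_, branchFun_mem h hN hd hS hf⟩
  have hcoe : ∀ P : F[X], ((aeval x' P : B) : L) = algebraMap K L (aeval x P) := fun P => by
    rw [← aeval_algebraMap_apply, ← Subalgebra.coe_val, ← aeval_algHom_apply]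
    rfl
  have hvd : v' ^ d = aeval x' u := by
    ext
    rw [hcoe, ← branchFun_pow h hN hS hf]
    rfl
  refine ⟨Equiv.ofBijective (fun φ => ⟨φ.1 v', ?_⟩) ⟨?_, ?_⟩⟩
  · rw [← map_pow, hvd, ← aeval_algHom_apply, φ.2, coe_aeval_eq_eval]
  · rintro ⟨φ, hφ⟩ ⟨ψ, hψ⟩ hφψ
    have hv := Subtype.ext_iff.1 hφψ
    refine Subtype.ext (AlgHom.ext fun b => ?_)
    obtain ⟨e, he⟩ := exists_apply_eq h hN hd hN' hcop hS hf hSc huc hgen hζ hNF (φ v') b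
    exact (he F φ hφ rfl).trans (he F ψ hψ hv.symm).symm
  · rintro ⟨w, hw⟩
    choose e he using exists_apply_eq h hN hd hN' hcop hS hf hSc huc hgen hζ hNF w
    -- `B` is integral over `F[x, v]`, the image of `ρ`; `ev` is evaluation at `x = c`, `v = w`.
    let ρ : F[X][X] →+* B := eval₂RingHom (aeval x').toRingHom v'
    have hρ : ρ.IsIntegral := by
      refine RingHom.IsIntegral.tower_top C ρ ?_
      have : ρ.comp C = (aeval x').toRingHom := by ext <;> simp [ρ]
      rw [this]
      exact isIntegral_aeval_self _
    let ev : F[X][X] →+* F := eval₂RingHom (evalRingHom c) w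
    have hev : Function.Surjective ev := fun a => ⟨C (C a), by simp [ev]⟩
    let : Algebra F[X][X] B := ρ.toAlgebra
    have : Algebra.IsIntegral F[X][X] B := ⟨hρ⟩
    have : (RingHom.ker ev).IsMaximal := RingHom.ker_isMaximal_of_surjective ev hev
    have hker : RingHom.ker (algebraMap F[X][X] B) ≤ RingHom.ker ev := by
      intro p hp
      have hp0 : ρ p = 0 := hp
      have h1 : X ^ d - C u ∣ p := by
        refine dvd_of_eval₂_branchFun_eq_zero h hx hN hd hN' hS hf p ?_
        have h2 := congrArg B.val hp0
        rw [map_zero] at h2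
        rw [← h2]
        change _ = (B.val : B →+* L) (eval₂ (aeval x').toRingHom v' p)
        rw [hom_eval₂]
        congr 1
        ext a
        · simp [← IsScalarTower.algebraMap_apply]
        · simp [hx']
      obtain ⟨q, rfl⟩ := h1
      rw [RingHom.mem_ker, map_mul]
      simp [ev, hw]
    obtain ⟨Q, hQ, hQc⟩ := Ideal.exists_ideal_over_maximal_of_isIntegral (RingHom.ker ev) hker
    have := hQ.isPrime
    have hmem : ∀ p, ev p = 0 → ρ p ∈ Q := fun p hp => by
      have : p ∈ Q.comap (algebraMap F[X][X] B) := hQc ▸ hp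
      exact this
    let π : B →ₐ[F] B ⧸ Q := Ideal.Quotient.mkₐ F Q
    have hπx : π x' = algebraMap F _ c := by
      have := hmem (C (X - C c)) (by simp [ev])
      rw [← sub_eq_zero, ← π.commutes, ← map_sub]
      refine Ideal.Quotient.eq_zero_iff_mem.2 ?_
      convert this using 1
      simp [ρ]
    have hπv : π v' = algebraMap F _ w := by
      have := hmem (X - C (C w)) (by simp [ev])
      rw [← sub_eq_zero, ← π.commutes, ← map_sub]
      refine Ideal.Quotient.eq_zero_iff_mem.2 ?_
      convert this using 1
      simp [ρ]
    -- The residue field at `Q` is `F`.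
    have hbij : Function.Bijective (Algebra.ofId F (B ⧸ Q)) := by
      refine ⟨(algebraMap F (B ⧸ Q)).injective, fun z => ?_⟩
      obtain ⟨b, rfl⟩ := Ideal.Quotient.mk_surjective z
      exact ⟨e b, (he b _ π hπx hπv).symm⟩
    let τ := AlgEquiv.ofBijective _ hbij
    have hτ : ∀ a, τ.symm (algebraMap F _ a) = a := fun a => τ.symm_apply_apply a
    refine ⟨⟨(τ.symm : B ⧸ Q →ₐ[F] F).comp π, ?_⟩, Subtype.ext ?_⟩
    · change τ.symm (π x') = c
      rw [hπx, hτ]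
    · change τ.symm (π v') = w
      rw [hπv, hτ]

end LyingOver

/-! ### The points of the curve over each point of the projective line -/

section Fibres

/-- If `K = F(x)`, every nonzero element of `K` is a power of the local parameter `κ (x - c)` times
a quotient of functions without zero or pole at `x = c`. -/
theorem exists_zpow_localParameter {F K : Type*} [Field F] [Field K] [Algebra F K] {x : K}
    (hfrac : ∀ g : K, ∃ P Q : F[X], aeval x Q ≠ 0 ∧ g * aeval x Q = aeval x P)
    {κ : F} (hκ : κ ≠ 0) (c : F) (hS : aeval x (C κ * (X - C c)) ≠ 0) (g : K) (hg : g ≠ 0) :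
    ∃ (r : ℤ) (A B : F[X]), A.eval c ≠ 0 ∧ B.eval c ≠ 0 ∧
      g * aeval x B = aeval x (C κ * (X - C c)) ^ r * aeval x A := by
  have key : ∀ P : F[X], P ≠ 0 → ∃ (a : ℕ) (A : F[X]), A.eval c ≠ 0 ∧
      P = (C κ * (X - C c)) ^ a * A := fun P hP => by
    obtain ⟨P₁, hP₁, hnd⟩ := exists_eq_pow_rootMultiplicity_mul_and_not_dvd P hP c
    set a := rootMultiplicity c P
    refine ⟨a, C (κ⁻¹ ^ a) * P₁, ?_, ?_⟩
    · rw [eval_mul, eval_C]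
      exact mul_ne_zero (pow_ne_zero _ (inv_ne_zero hκ)) fun h => hnd (dvd_iff_isRoot.2 h)
    · have : (C κ : F[X]) ^ a * C (κ⁻¹ ^ a) = 1 := by
        rw [← C_pow, ← C_mul, ← mul_pow, mul_inv_cancel₀ hκ, one_pow, C_1]
      rw [mul_pow, mul_mul_mul_comm, this, one_mul]
      exact hP₁
  obtain ⟨P, Q, hQ, hPQ⟩ := hfrac g
  have hP0 : P ≠ 0 := fun h => by
    rw [h, map_zero] at hPQ
    exact mul_ne_zero hg hQ hPQ
  have hQ0 : Q ≠ 0 := fun h => hQ (by rw [h, map_zero])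
  obtain ⟨a, A, hA, rfl⟩ := key P hP0
  obtain ⟨b, B, hB, rfl⟩ := key Q hQ0
  refine ⟨a - b, A, B, hA, hB, ?_⟩
  rw [map_mul, map_mul, map_pow, map_pow] at hPQ
  rw [zpow_sub₀ hS, zpow_natCast, zpow_natCast, div_mul_eq_mul_div, eq_div_iff (pow_ne_zero _ hS),
    ← hPQ]
  ring

theorem ratFunc_exists_aeval_X {F : Type*} [Field F] (g : RatFunc F) :
    ∃ P Q : F[X], aeval (RatFunc.X : RatFunc F) Q ≠ 0 ∧
      g * aeval (RatFunc.X : RatFunc F) Q = aeval RatFunc.X P := by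
  have hd : algebraMap F[X] (RatFunc F) g.denom ≠ 0 := RatFunc.algebraMap_ne_zero g.denom_ne_zero
  refine ⟨g.num, g.denom, ?_, ?_⟩
  · rwa [RatFunc.aeval_X_left_eq_algebraMap]
  · rw [RatFunc.aeval_X_left_eq_algebraMap, RatFunc.aeval_X_left_eq_algebraMap]
    exact ((div_eq_iff hd).1 (RatFunc.num_div_denom g)).symm

theorem ratFunc_exists_aeval_X_inv {F : Type*} [Field F] (g : RatFunc F) :
    ∃ P Q : F[X], aeval (RatFunc.X : RatFunc F)⁻¹ Q ≠ 0 ∧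
      g * aeval (RatFunc.X : RatFunc F)⁻¹ Q = aeval (RatFunc.X : RatFunc F)⁻¹ P := by
  have hX : (RatFunc.X : RatFunc F) ≠ 0 := RatFunc.X_ne_zero
  have hrev : ∀ P : F[X], aeval (RatFunc.X : RatFunc F) P =
      aeval (RatFunc.X : RatFunc F)⁻¹ P.reverse * RatFunc.X ^ P.natDegree := fun P => by
    let _ : Invertible (RatFunc.X : RatFunc F) := invertibleOfNonzero hX
    rw [aeval_def, ← eval₂_reverse_mul_pow, invOf_eq_inv, ← aeval_def]
  obtain ⟨P, Q, hQ, hPQ⟩ := ratFunc_exists_aeval_X g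
  rw [hrev] at hQ
  rw [hrev, hrev] at hPQ
  refine ⟨P.reverse * X ^ Q.natDegree, Q.reverse * X ^ P.natDegree, ?_, ?_⟩
  · rw [map_mul, map_pow, aeval_X]
    exact mul_ne_zero (left_ne_zero_of_mul hQ) (pow_ne_zero _ (inv_ne_zero hX))
  · rw [map_mul, map_mul, map_pow, map_pow, aeval_X, inv_pow, inv_pow, ← mul_assoc,
      ← div_eq_mul_inv, ← div_eq_mul_inv, div_eq_div_iff (pow_ne_zero _ hX) (pow_ne_zero _ hX),
      ← hPQ]
    ring

variable {F : Type*} [Field F] (N i j k : ℕ) (lam : F)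

theorem nonempty_fibre_coe_equiv_algHom (c : F) :
    Nonempty ({Q : RationalPoint N i j k lam // Q.x = (c : OnePoint F)} ≃
      {φ : normalClosureAdjoin F (xFun N i j k lam) →ₐ[F] F //
        φ ⟨_, self_mem_normalClosureAdjoin F _⟩ = c}) := by
  refine ⟨(Equiv.ofBijective (fun φ => ⟨.finite φ.1, congrArg _ φ.2⟩) ⟨?_, ?_⟩).symm⟩
  · intro φ ψ h
    exact Subtype.ext (RationalPoint.finite.inj (Subtype.ext_iff.1 h))
  · rintro ⟨φ | ⟨φ, hφ⟩, h⟩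
    · exact ⟨⟨φ, OnePoint.coe_injective h⟩, rfl⟩
    · exact absurd h (OnePoint.infty_ne_coe c)

theorem nonempty_fibre_infty_equiv_algHom :
    Nonempty ({Q : RationalPoint N i j k lam // Q.x = OnePoint.infty} ≃
      {φ : normalClosureAdjoin F (xInvFun N i j k lam) →ₐ[F] F //
        φ ⟨_, self_mem_normalClosureAdjoin F _⟩ = 0}) := by
  refine ⟨(Equiv.ofBijective (fun φ => ⟨.infinite φ.1 φ.2, rfl⟩) ⟨?_, ?_⟩).symm⟩
  · intro φ ψ h
    exact Subtype.ext (RationalPoint.infinite.inj (Subtype.ext_iff.1 h))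
  · rintro ⟨φ | ⟨φ, hφ⟩, h⟩
    · exact absurd h (OnePoint.coe_ne_infty _)
    · exact ⟨⟨φ, hφ⟩, rfl⟩

variable {N i j k lam}

theorem nonempty_fibre_coe_equiv (hN0 : N ≠ 0) {ζ : F} (hζ : IsPrimitiveRoot ζ N)
    (hNF : (N : F) ≠ 0) {κ : F} (hκ : κ ≠ 0) {c : F} {m : ℕ} {u : F[X]} {a : F}
    (hu : u.eval c = a) (ha : a ≠ 0) (hf : legendrePoly i j k lam = (C κ * (X - C c)) ^ m * u) :
    Nonempty ({Q : RationalPoint N i j k lam // Q.x = (c : OnePoint F)} ≃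
      {w : F // w ^ Nat.gcd N m = a}) := by
  subst hu
  have hS : aeval (RatFunc.X : RatFunc F) (C κ * (X - C c)) ≠ 0 := by
    rw [RatFunc.aeval_X_left_eq_algebraMap]
    exact RatFunc.algebraMap_ne_zero (mul_ne_zero (C_ne_zero.2 hκ) (X_sub_C_ne_zero c))
  obtain ⟨e₁⟩ := nonempty_fibre_coe_equiv_algHom N i j k lam c
  obtain ⟨e₂⟩ := nonempty_algHom_equiv_pow_eq
    (AdjoinRoot.isAdjoinRoot ((X : (RatFunc F)[X]) ^ N -
      C (algebraMap F[X] (RatFunc F) (legendrePoly i j k lam))))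
    RatFunc.transcendental_X hN0 (n := m) hS
    (by rw [hf, zpow_natCast, map_mul, map_pow, RatFunc.aeval_X_left_eq_algebraMap,
      RatFunc.aeval_X_left_eq_algebraMap])
    (by simp) ha (exists_zpow_localParameter ratFunc_exists_aeval_X hκ c hS) hζ hNF
  exact ⟨e₁.trans e₂⟩

/-- At infinity `f = s ^ (-(i + j + k)) (s - 1) ^ j (s - lam) ^ k` with `s = 1 / x`. -/
theorem nonempty_fibre_infty_equiv (hN0 : N ≠ 0) {ζ : F} (hζ : IsPrimitiveRoot ζ N)
    (hNF : (N : F) ≠ 0) (hlam0 : lam ≠ 0) :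
    Nonempty ({Q : RationalPoint N i j k lam // Q.x = OnePoint.infty} ≃
      {w : F // w ^ Nat.gcd N (i + j + k) = (-1) ^ j * (-lam) ^ k}) := by
  have hX : (RatFunc.X : RatFunc F) ≠ 0 := RatFunc.X_ne_zero
  have hS : aeval (RatFunc.X : RatFunc F)⁻¹ (C (1 : F) * (X - C 0)) ≠ 0 := by simpa using hX
  have htr : Transcendental F (RatFunc.X : RatFunc F)⁻¹ := fun h =>
    RatFunc.transcendental_X (IsAlgebraic.inv_iff.1 h)
  have hev : ((X - 1) ^ j * (X - C lam) ^ k : F[X]).eval 0 = (-1) ^ j * (-lam) ^ k := by simp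
  obtain ⟨e₁⟩ := nonempty_fibre_infty_equiv_algHom N i j k lam
  obtain ⟨e₂⟩ := nonempty_algHom_equiv_pow_eq
    (AdjoinRoot.isAdjoinRoot ((X : (RatFunc F)[X]) ^ N -
      C (algebraMap F[X] (RatFunc F) (legendrePoly i j k lam))))
    htr hN0 (n := -((i + j + k : ℕ) : ℤ)) (u := (X - 1) ^ j * (X - C lam) ^ k) hS
    (by
      have h1 : (RatFunc.X : RatFunc F)⁻¹ - 1 = RatFunc.X⁻¹ * (1 - RatFunc.X) := by
        rw [mul_sub, mul_one, inv_mul_cancel₀ hX]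
      have h2 : (RatFunc.X : RatFunc F)⁻¹ - RatFunc.C lam =
          RatFunc.X⁻¹ * (1 - RatFunc.C lam * RatFunc.X) := by
        field_simp
      have h3 : (RatFunc.X : RatFunc F)⁻¹ ^ (-((i + j + k : ℕ) : ℤ)) =
          RatFunc.X ^ i * RatFunc.X ^ j * RatFunc.X ^ k := by
        rw [inv_zpow', neg_neg, zpow_natCast, pow_add, pow_add]
      have h4 : ∀ n : ℕ, (RatFunc.X : RatFunc F) ^ n * RatFunc.X⁻¹ ^ n = 1 := fun n => by
        rw [← mul_pow, mul_inv_cancel₀ hX, one_pow]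
      simp only [legendrePoly, map_mul, map_pow, map_sub, map_one, RatFunc.algebraMap_X, aeval_X,
        aeval_C, map_zero, sub_zero, one_mul, RatFunc.algebraMap_C, RatFunc.algebraMap_eq_C]
      rw [h1, h2, h3, mul_pow, mul_pow]
      calc _ = RatFunc.X ^ i * (1 - RatFunc.X) ^ j * (1 - RatFunc.C lam * RatFunc.X) ^ k *
            (RatFunc.X ^ j * RatFunc.X⁻¹ ^ j) * (RatFunc.X ^ k * RatFunc.X⁻¹ ^ k) := by
              rw [h4, h4, mul_one, mul_one]
        _ = _ := by ring)
    (by simp) (by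
      rw [hev]
      exact mul_ne_zero (pow_ne_zero _ (neg_ne_zero.2 one_ne_zero))
        (pow_ne_zero _ (neg_ne_zero.2 hlam0)))
    (exists_zpow_localParameter ratFunc_exists_aeval_X_inv one_ne_zero 0 hS) hζ hNF
  rw [Int.gcd_neg, Int.gcd_natCast_natCast, hev] at e₂
  exact ⟨e₁.trans e₂⟩

end Fibres

/-! ### Character sums -/

section CharacterSums

variable {F : Type*} [Field F] [Fintype F] {N : ℕ}

theorem natCast_ne_zero_of_card_modEq (hq : Fintype.card F ≡ 1 [MOD N]) : (N : F) ≠ 0 := by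
  intro h
  obtain ⟨t, ht⟩ := (Nat.modEq_iff_dvd' Fintype.card_pos).1 hq.symm
  have h1 : Fintype.card F = N * t + 1 := by
    have : 0 < Fintype.card F := Fintype.card_pos
    omega
  have h2 := FiniteField.cast_card_eq_zero F
  rw [h1, Nat.cast_add, Nat.cast_mul, h, zero_mul, zero_add, Nat.cast_one] at h2
  exact one_ne_zero h2

theorem exists_isPrimitiveRoot_of_card_modEq (hq : Fintype.card F ≡ 1 [MOD N]) :
    ∃ ζ : F, IsPrimitiveRoot ζ N := by
  classical
  obtain ⟨g, hg⟩ := IsCyclic.exists_ofOrder_eq_natCard (α := Fˣ)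
  obtain ⟨t, ht⟩ := (Nat.modEq_iff_dvd' Fintype.card_pos).1 hq.symm
  rw [Nat.card_eq_fintype_card, Fintype.card_units] at hg
  have h1 : IsPrimitiveRoot g (Fintype.card F - 1) := hg ▸ IsPrimitiveRoot.orderOf g
  have h2 : 0 < Fintype.card F - 1 := Nat.sub_pos_of_lt Fintype.one_lt_card
  exact ⟨_, IsPrimitiveRoot.coe_units_iff.2 (h1.pow h2 (by rw [ht, mul_comm]))⟩

/-- A character of order `N` detects `N`-th powers. -/
theorem exists_pow_eq_of_apply_eq_one {ξ : MulChar F ℂ} (hξ : orderOf ξ = N) {a : F} (ha : a ≠ 0)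
    (h : ξ a = 1) : ∃ w : F, w ^ N = a := by
  obtain ⟨g, hg⟩ := IsCyclic.exists_zpow_surjective (G := Fˣ)
  have hg' : ∀ x, x ∈ Subgroup.zpowers g := hg
  obtain ⟨t, ht⟩ := (mem_powers_iff_mem_zpowers).2 (hg' (Units.mk0 a ha))
  have hta : ((g : F)) ^ t = a := by
    have := congrArg Units.val ht
    simpa using this
  have h1 : ξ ^ t = 1 := by
    rw [MulChar.eq_iff hg', MulChar.pow_apply_coe, ← map_pow, hta, h, MulChar.one_apply_coe]
  obtain ⟨l, rfl⟩ := hξ ▸ orderOf_dvd_of_pow_eq_one h1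
  exact ⟨(g : F) ^ l, by rw [← pow_mul, mul_comm, hta]⟩

theorem card_pow_eq_sum_mulChar {ξ : MulChar F ℂ} (hξ : orderOf ξ = N) (hN0 : N ≠ 0)
    {ζ : F} (hζ : IsPrimitiveRoot ζ N) {a : F} (ha : a ≠ 0) :
    (Nat.card {w : F // w ^ N = a} : ℂ) = ∑ m ∈ Finset.range N, ξ a ^ m := by
  classical
  have hpow : ξ a ^ N = 1 := by
    have h1 : ξ ^ N = 1 := hξ ▸ pow_orderOf_eq_one ξ
    rw [← MulChar.pow_apply' ξ hN0, h1, MulChar.one_apply (isUnit_iff_ne_zero.2 ha)]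
  have hcard : Nat.card {w : F // w ^ N = a} = Multiset.card (nthRoots N a) := by
    rw [Nat.card_eq_fintype_card, ← Multiset.toFinset_card_of_nodup (hζ.nthRoots_nodup ha)]
    refine Fintype.card_of_subtype _ fun w => ?_
    rw [Multiset.mem_toFinset, mem_nthRoots (Nat.pos_of_ne_zero hN0)]
  rw [hcard]
  by_cases h : ∃ w, w ^ N = a
  · rw [hζ.card_nthRoots, if_pos h]
    obtain ⟨w, rfl⟩ := h
    have hw : w ≠ 0 := fun h0 => ha (by rw [h0, zero_pow hN0])
    have h1 : ξ (w ^ N) = 1 := by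
      rw [map_pow, ← MulChar.pow_apply' ξ hN0, show ξ ^ N = 1 from hξ ▸ pow_orderOf_eq_one ξ,
        MulChar.one_apply (isUnit_iff_ne_zero.2 hw)]
    simp [h1]
  · have h1 : ξ a ≠ 1 := fun h1 => h (exists_pow_eq_of_apply_eq_one hξ ha h1)
    have := geom_sum_mul (ξ a) N
    rw [hpow, sub_self] at this
    rw [hζ.card_nthRoots, if_neg h, (mul_eq_zero.1 this).resolve_right (sub_ne_zero.2 h1),
      Nat.cast_zero]

/-- The sign `ξ ^ (m j) (-1)` cancels the factor `B C (-1)` of the hypergeometric function. -/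
theorem card_mul_mulChar_mul_hyp2F1 (ξ : MulChar F ℂ) {i j k m : ℕ} (hi : i ≠ 0) (hj : j ≠ 0)
    (hk : k ≠ 0) (hm : m ≠ 0) {lam : F} (hlam0 : lam ≠ 0) :
    (Fintype.card F : ℂ) * ((ξ ^ (m * j)) (-1) *
      hyp2F1 (ξ ^ (-((k * m : ℕ) : ℤ))) (ξ ^ (i * m)) (ξ ^ (m * (i + j))) lam) =
      ∑ x : F, ξ ((legendrePoly i j k lam).eval x) ^ m := by
  have hq : (Fintype.card F : ℂ) ≠ 0 := by exact_mod_cast Fintype.card_ne_zero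
  have hBC : (ξ ^ (i * m))⁻¹ * ξ ^ (m * (i + j)) = ξ ^ (m * j) := by
    rw [inv_mul_eq_iff_eq_mul, ← pow_add]
    congr 1
    ring
  have hA : (ξ ^ (-((k * m : ℕ) : ℤ)))⁻¹ = ξ ^ (k * m) := by
    rw [zpow_neg, inv_inv, zpow_natCast]
  have hsign : (ξ ^ (m * j)) (-1) * (ξ ^ (i * m) * ξ ^ (m * (i + j))) (-1) = 1 := by
    rw [← MulChar.mul_apply, ← pow_add, ← pow_add,
      show m * j + (i * m + m * (i + j)) = 2 * (m * i + m * j) by ring,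
      MulChar.pow_apply' _ (by simp [hm, hi]), pow_mul, ← map_pow, neg_one_sq, map_one, one_pow]
  have hsum : ∀ x : F, (ξ ^ (i * m)) x * (ξ ^ (m * j)) (1 - x) * (ξ ^ (k * m)) (1 - lam * x) =
      ξ ((legendrePoly i j k lam).eval x) ^ m := fun x => by
    rw [MulChar.pow_apply' _ (mul_ne_zero hi hm), MulChar.pow_apply' _ (mul_ne_zero hm hj),
      MulChar.pow_apply' _ (mul_ne_zero hk hm)]
    simp only [legendrePoly, eval_mul, eval_pow, eval_X, eval_sub, eval_one, eval_C, map_mul,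
      map_pow]
    ring
  rw [hyp2F1, hBC, hA, MulChar.one_apply (isUnit_iff_ne_zero.2 hlam0)]
  simp_rw [hsum]
  rw [one_mul, ← mul_assoc, ← mul_assoc, mul_assoc (Fintype.card F : ℂ), mul_div_assoc', hsign,
    mul_one_div_cancel hq, one_mul]

end CharacterSums

/-! ### Counting all points -/

section Count

variable {F : Type*} [Field F] {N i j k : ℕ} {lam : F}

theorem nonempty_fibre_zero_equiv (hN0 : N ≠ 0) {ζ : F} (hζ : IsPrimitiveRoot ζ N)
    (hNF : (N : F) ≠ 0) :
    Nonempty ({Q : RationalPoint N i j k lam // Q.x = ((0 : F) : OnePoint F)} ≃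
      {w : F // w ^ Nat.gcd N i = 1}) :=
  nonempty_fibre_coe_equiv hN0 hζ hNF (u := (1 - X) ^ j * (1 - C lam * X) ^ k)
    (one_ne_zero (α := F)) (by simp) one_ne_zero (by simp [legendrePoly, mul_assoc])

theorem nonempty_fibre_one_equiv (hN0 : N ≠ 0) {ζ : F} (hζ : IsPrimitiveRoot ζ N)
    (hNF : (N : F) ≠ 0) (hlam1 : lam ≠ 1) :
    Nonempty ({Q : RationalPoint N i j k lam // Q.x = ((1 : F) : OnePoint F)} ≃
      {w : F // w ^ Nat.gcd N j = (1 - lam) ^ k}) :=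
  nonempty_fibre_coe_equiv hN0 hζ hNF (u := X ^ i * (1 - C lam * X) ^ k) (κ := -1)
    (neg_ne_zero.2 one_ne_zero) (by simp) (pow_ne_zero _ (sub_ne_zero.2 hlam1.symm)) (by
      rw [show (C (-1 : F)) * (X - C 1) = 1 - X by simp, legendrePoly]
      ring)

theorem nonempty_fibre_inv_equiv (hN0 : N ≠ 0) {ζ : F} (hζ : IsPrimitiveRoot ζ N)
    (hNF : (N : F) ≠ 0) (hlam0 : lam ≠ 0) (hlam1 : lam ≠ 1) :
    Nonempty ({Q : RationalPoint N i j k lam // Q.x = ((1 / lam : F) : OnePoint F)} ≃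
      {w : F // w ^ Nat.gcd N k = (1 / lam) ^ i * (1 - 1 / lam) ^ j}) :=
  nonempty_fibre_coe_equiv hN0 hζ hNF (u := X ^ i * (1 - X) ^ j) (κ := -lam)
    (neg_ne_zero.2 hlam0) (by simp)
    (mul_ne_zero (pow_ne_zero _ (one_div_ne_zero hlam0))
      (pow_ne_zero _ (sub_ne_zero.2 fun h => hlam1 (by
        rw [eq_div_iff hlam0, one_mul] at h
        exact h)))) (by
      have h1 : (C lam : F[X]) * C (1 / lam) = 1 := by
        rw [← C_mul, mul_one_div_cancel hlam0, C_1]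
      rw [show (C (-lam) : F[X]) * (X - C (1 / lam)) = 1 - C lam * X by
        rw [C_neg, neg_mul, mul_sub, h1, neg_sub], legendrePoly]
      ring)

theorem nonempty_fibre_regular_equiv (hN0 : N ≠ 0) {ζ : F} (hζ : IsPrimitiveRoot ζ N)
    (hNF : (N : F) ≠ 0) {c : F} (hc : (legendrePoly i j k lam).eval c ≠ 0) :
    Nonempty ({Q : RationalPoint N i j k lam // Q.x = (c : OnePoint F)} ≃
      {w : F // w ^ N = (legendrePoly i j k lam).eval c}) := by
  have := nonempty_fibre_coe_equiv hN0 hζ hNF (u := legendrePoly i j k lam) (m := 0)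
    (one_ne_zero (α := F)) rfl hc (by rw [pow_zero, one_mul])
  rwa [Nat.gcd_zero_right] at this

theorem nInfty_eq_card (hN0 : N ≠ 0) :
    nInfty N i j k lam = Nat.card {w : F // w ^ Nat.gcd N (i + j + k) = (-1) ^ j * (-lam) ^ k} := by
  have hle : i + j + k ≤ N * ((i + j + k) / N + 1) :=
    (Nat.lt_mul_div_succ _ (Nat.pos_of_ne_zero hN0)).le
  rw [nInfty, resolutionCount, Nat.gcd_sub_left_right_of_dvd _ hle (Dvd.intro _ rfl)]

theorem eval_legendrePoly_eq_zero (hi : i ≠ 0) (hj : j ≠ 0) (hk : k ≠ 0) (hlam0 : lam ≠ 0) {c : F} :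
    (legendrePoly i j k lam).eval c = 0 ↔ c = 0 ∨ c = 1 ∨ c = 1 / lam := by
  have h1 : 1 - lam * c = 0 ↔ c = 1 / lam := by
    rw [sub_eq_zero, eq_div_iff hlam0, mul_comm, eq_comm]
  simp [legendrePoly, hi, hj, hk, h1, sub_eq_zero, or_assoc, eq_comm (a := (1 : F))]

variable [Fintype F]

theorem finite_fibre (hN0 : N ≠ 0) {ζ : F} (hζ : IsPrimitiveRoot ζ N) (hNF : (N : F) ≠ 0)
    (hlam0 : lam ≠ 0) (hlam1 : lam ≠ 1) (hi : i ≠ 0) (hj : j ≠ 0) (hk : k ≠ 0) (P : OnePoint F) :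
    Finite {Q : RationalPoint N i j k lam // Q.x = P} := by
  induction P using OnePoint.rec with
  | infty =>
    obtain ⟨e⟩ := nonempty_fibre_infty_equiv (i := i) (j := j) (k := k) hN0 hζ hNF hlam0
    exact Finite.of_equiv _ e.symm
  | coe c =>
    by_cases hc : (legendrePoly i j k lam).eval c = 0
    · rcases (eval_legendrePoly_eq_zero hi hj hk hlam0).1 hc with rfl | rfl | rfl
      · obtain ⟨e⟩ := nonempty_fibre_zero_equiv (i := i) (j := j) (k := k) (lam := lam) hN0 hζ hNF
        exact Finite.of_equiv _ e.symm
      · obtain ⟨e⟩ := nonempty_fibre_one_equiv (i := i) (j := j) (k := k) hN0 hζ hNF hlam1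
        exact Finite.of_equiv _ e.symm
      · obtain ⟨e⟩ := nonempty_fibre_inv_equiv (i := i) (j := j) (k := k) hN0 hζ hNF hlam0 hlam1
        exact Finite.of_equiv _ e.symm
    · obtain ⟨e⟩ := nonempty_fibre_regular_equiv hN0 hζ hNF hc
      exact Finite.of_equiv _ e.symm

theorem card_rationalPoint_eq_sum
    (hfin : ∀ P : OnePoint F, Finite {Q : RationalPoint N i j k lam // Q.x = P}) :
    Nat.card (RationalPoint N i j k lam) =
      numPointsOver N i j k lam OnePoint.infty + ∑ c : F, numPointsOver N i j k lam c := by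
  rw [← Nat.card_congr (Equiv.sigmaFiberEquiv (RationalPoint.x (N := N) (i := i) (j := j) (k := k)
    (lam := lam))), Nat.card_sigma]
  exact Fintype.sum_option fun P : Option F => numPointsOver N i j k lam P

end Count

end GenLegendre

theorem mainTheorem3 {F : Type*} [Field F] [Fintype F] (p : ℕ) [CharP F p] (hp : 3 < p)
    (N i j k : ℕ) (hq : Fintype.card F ≡ 1 [MOD N])
    (hi : 1 ≤ i) (hiN : i < N) (hj : 1 ≤ j) (hjN : j < N) (hk : 1 ≤ k) (hkN : k < N)
    (ξ : MulChar F ℂ) (hξ : orderOf ξ = N)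
    (lam : F) (hlam0 : lam ≠ 0) (hlam1 : lam ≠ 1) :
    GenLegendre.numPointsOver N i j k lam ((0 : F) : OnePoint F) = GenLegendre.nZero F N i ∧
    GenLegendre.numPointsOver N i j k lam ((1 : F) : OnePoint F) = GenLegendre.nOne N j k lam ∧
    GenLegendre.numPointsOver N i j k lam ((1 / lam : F) : OnePoint F) =
      GenLegendre.nInvLam N i j k lam ∧
    GenLegendre.numPointsOver N i j k lam OnePoint.infty = GenLegendre.nInfty N i j k lam ∧
    Finite (GenLegendre.RationalPoint N i j k lam) ∧
    (Nat.card (GenLegendre.RationalPoint N i j k lam) : ℂ) =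
      1 + (Fintype.card F : ℂ) +
        (Fintype.card F : ℂ) * ∑ m ∈ Finset.Icc 1 (N - 1),
          (ξ ^ (m * j)) (-1) *
            GenLegendre.hyp2F1 (ξ ^ (-((k * m : ℕ) : ℤ))) (ξ ^ (i * m)) (ξ ^ (m * (i + j))) lam +
        (GenLegendre.nZero F N i : ℂ) + (GenLegendre.nOne N j k lam : ℂ) +
        (GenLegendre.nInvLam N i j k lam : ℂ) + (GenLegendre.nInfty N i j k lam : ℂ) - 4 := by
  classical
  have hN0 : N ≠ 0 := by omega
  have hi0 : i ≠ 0 := by omega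
  have hj0 : j ≠ 0 := by omega
  have hk0 : k ≠ 0 := by omega
  have hNF : (N : F) ≠ 0 := GenLegendre.natCast_ne_zero_of_card_modEq hq
  obtain ⟨ζ, hζ⟩ := GenLegendre.exists_isPrimitiveRoot_of_card_modEq hq
  have h0 : GenLegendre.numPointsOver N i j k lam ((0 : F) : OnePoint F) =
      GenLegendre.nZero F N i :=
    (GenLegendre.nonempty_fibre_zero_equiv hN0 hζ hNF).elim Nat.card_congr
  have h1 : GenLegendre.numPointsOver N i j k lam ((1 : F) : OnePoint F) =
      GenLegendre.nOne N j k lam :=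
    (GenLegendre.nonempty_fibre_one_equiv hN0 hζ hNF hlam1).elim Nat.card_congr
  have hinv : GenLegendre.numPointsOver N i j k lam ((1 / lam : F) : OnePoint F) =
      GenLegendre.nInvLam N i j k lam :=
    (GenLegendre.nonempty_fibre_inv_equiv hN0 hζ hNF hlam0 hlam1).elim Nat.card_congr
  have hinfty : GenLegendre.numPointsOver N i j k lam OnePoint.infty =
      GenLegendre.nInfty N i j k lam :=
    ((GenLegendre.nonempty_fibre_infty_equiv hN0 hζ hNF hlam0).elim Nat.card_congr).trans
      (GenLegendre.nInfty_eq_card hN0).symm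
  have hfin := GenLegendre.finite_fibre (i := i) (j := j) (k := k) hN0 hζ hNF hlam0 hlam1 hi0 hj0 hk0
  refine ⟨h0, h1, hinv, hinfty, Finite.of_equiv _ (Equiv.sigmaFiberEquiv
    (GenLegendre.RationalPoint.x (N := N) (i := i) (j := j) (k := k) (lam := lam))), ?_⟩
  have hne1 : (1 : F) / lam ≠ 1 := fun h => hlam1 ((div_eq_one_iff_eq hlam0).1 h).symm
  have hne0 : (1 : F) / lam ≠ 0 := one_div_ne_zero hlam0
  -- The singular points, where the character sum vanishes, enter as corrections to `1 + ∑`.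
  have hloc : ∀ c : F, (GenLegendre.numPointsOver N i j k lam (c : OnePoint F) : ℂ) =
      1 + ∑ m ∈ Finset.Icc 1 (N - 1), ξ ((GenLegendre.legendrePoly i j k lam).eval c) ^ m +
        (if c = 0 then (GenLegendre.nZero F N i : ℂ) - 1 else 0) +
        (if c = 1 then (GenLegendre.nOne N j k lam : ℂ) - 1 else 0) +
        (if c = 1 / lam then (GenLegendre.nInvLam N i j k lam : ℂ) - 1 else 0) := fun c => by
    by_cases hc : (GenLegendre.legendrePoly i j k lam).eval c = 0
    · have hsum : ∑ m ∈ Finset.Icc 1 (N - 1),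
          ξ ((GenLegendre.legendrePoly i j k lam).eval c) ^ m = 0 :=
        Finset.sum_eq_zero fun m hm => by
          rw [hc, MulChar.map_zero, zero_pow (by have := (Finset.mem_Icc.1 hm).1; omega)]
      rw [hsum]
      rcases (GenLegendre.eval_legendrePoly_eq_zero hi0 hj0 hk0 hlam0).1 hc with rfl | rfl | rfl
      · rw [h0, if_pos rfl, if_neg zero_ne_one, if_neg hne0.symm]
        ring
      · rw [h1, if_neg one_ne_zero, if_pos rfl, if_neg hne1.symm]
        ring
      · rw [hinv, if_neg hne0, if_neg hne1, if_pos rfl]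
        ring
    · have hc' := fun h => hc ((GenLegendre.eval_legendrePoly_eq_zero hi0 hj0 hk0 hlam0).2 h)
      rw [if_neg fun h => hc' (Or.inl h), if_neg fun h => hc' (Or.inr (Or.inl h)),
        if_neg fun h => hc' (Or.inr (Or.inr h)), GenLegendre.numPointsOver,
        (GenLegendre.nonempty_fibre_regular_equiv hN0 hζ hNF hc).elim Nat.card_congr,
        GenLegendre.card_pow_eq_sum_mulChar hξ hN0 hζ hc, Finset.range_eq_Ico,
        Finset.sum_eq_sum_Ico_succ_bot (Nat.pos_of_ne_zero hN0), pow_zero, zero_add,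
        show Finset.Ico 1 N = Finset.Icc 1 (N - 1) by ext; simp; omega]
      ring
  rw [GenLegendre.card_rationalPoint_eq_sum hfin, hinfty, Nat.cast_add, Nat.cast_sum]
  simp_rw [hloc, Finset.sum_add_distrib]
  rw [Finset.sum_comm, Finset.sum_ite_eq' , Finset.sum_ite_eq', Finset.sum_ite_eq',
    if_pos (Finset.mem_univ _), if_pos (Finset.mem_univ _), if_pos (Finset.mem_univ _),
    Finset.mul_sum, Finset.sum_congr rfl fun m hm =>
      GenLegendre.card_mul_mulChar_mul_hyp2F1 ξ hi0 hj0 hk0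
        (by have := (Finset.mem_Icc.1 hm).1; omega) hlam0,
    Finset.sum_const, Finset.card_univ, nsmul_eq_mul]
  ring
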